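/- Let $S_0=\{s_1,\dots,s_r\}$ be independent, pairwise commuting $n$-qubit Pauli operators (considered up to phase), and let $\mathcal C$ be the stabilizer code on which $s_i$ has a prescribed eigenvalue $\sigma_i=\pm1$. An unknown Pauli error $E$ acts on an unknown state of $\mathcal C$; then Pauli operators $m_1,m_2,\dots,m_l$ are measured one after the other, without further errors. (A round of commuting measurements is listed in any order.) The syndrome of $s\in\langle S_0\rangle$ is $0$ or $1$ according to whether $E$ and $s$ commute or anti-commute. It *can be obtained* through the sequence if it is a function of the measurement record: one fixed function of the operators and their outcomes gives the syndrome for all code states, all Pauli errors $E$, and all records of positive probability. In this case $s$ is *unmasked*; $s$ is *temporarily masked* if its syndrome cannot be obtained through $m_1,\dots,m_l$ but can be through some extension $m_1,\dots,m_l,m_{l+1},\dots,m_{l'}$; $s$ is *permanently masked* if its syndrome cannot be obtained through $m_1,\dots,m_l$ or any extension of it. The algorithm keeps a collection $C$ of Pauli operators $c$, each with an associated stabilizer $s_c\in\langle S_0\rangle$ (equal operators with different associated stabilizers count as different elements), and a collection $V$ of Pauli operators. Initially $C=S_0$ with $s_c=c$, and $V=\emptyset$. A measurement $m$ updates them as follows;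 all products are up to phase, and the element to be removed is an arbitrary one. * Case 1: $m$ commutes with all of $C$ and $V$. Add $m$ to $V$ if $m\notin\langle V\rangle$. * Case 2: $m$ commutes with all of $V$ but not with all of $C$. Remove from $C$ an element $c_j$ that anti-commutes with $m$, replace every other $c_i\in C$ that anti-commutes with $m$ by $c_ic_j$, with associated stabilizer $s_{c_i}s_{c_j}$, and add $m$ to $V$. * Case 3: $m$ commutes with all of $C$ but not with all of $V$. Remove from $V$ an element $v_j$ that anti-commutes with $m$, replace every other $v_i\in V$ that anti-commutes with $m$ by $v_iv_j$, and add $m$ to $V$. * Case 4: $m$ anti-commutes with some element of $C$ and some element of $V$. Update $V$ as in Case 3, removing $v_j$, and replace every $c_i\in C$ that anti-commutes with $m$ by $c_iv_j$, with unchanged associated stabilizer. At the end, $U$ is a generating set of the group of stabilizers associated with the elements of $\langle C\rangle\cap\langle V\rangle$. Here the elements of $\langle C\rangle$ are products of elements of $C$ together with the corresponding products of associated stabilizers, and the identity operator may carry a nontrivial associated stabilizer. $T$ is the set of stabilizers associated with elements of $C$ that are not in $\langle U\rangle$. Then for every choice of the removed elements the following holds. 1. If the measurement $m_k$ removes an element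 $c$ from $C$ (Case 2) and its associated stabilizer $s_c$ has not been unmasked by $m_1,\dots,m_{k-1}$, then $s_c\in\langle S_0\rangle$ is permanently masked by $m_1,\dots,m_k$: its syndrome cannot be obtained through $m_1,\dots,m_k$ or through any extension of this sequence. 2. For every measurement sequence, the set of its permanently masked stabilizers is $\langle S_0\rangle\setminus\langle T\rangle\langle U\rangle$. The same holds if $U$ and $T$ denote, instead of the output of the algorithm, the sets of all unmasked and of all temporarily masked stabilizers in $\langle S_0\rangle$. -/

import Mathlib

open scoped Matrix

namespace DynCode

/-! ### Unsigned Pauli operators and their matrices -/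

/-- Unsigned `n`-qubit Pauli operators (Pauli operators up to phase) in the binary representation:
the pair `(a, b)` at position `j` stands for `X ^ a * Z ^ b` (up to phase) on qubit `j`.  The product
of Pauli operators up to phase is the sum of vectors, the identity is `0`, and the group `⟨A⟩`
generated by a set `A` of unsigned Pauli operators is `Submodule.span (ZMod 2) A`. -/
abbrev Pauli (n : ℕ) : Type := Fin n → ZMod 2 × ZMod 2

/-- The symplectic inner product `p ⊙ q`. It is `0` if the two operators commute and `1` if they
anti-commute. -/
def symp {n : ℕ} (p q : Pauli n) : ZMod 2 := ∑ j, ((p j).1 * (q j).2 + (p j).2 * (q j).1)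

/-- The single-qubit matrices `I`, `X`, `Z`, `Y`. -/
noncomputable def pauliMat (p : ZMod 2 × ZMod 2) : Matrix (Fin 2) (Fin 2) ℂ :=
  if p.1 = 0 then
    if p.2 = 0 then 1 else !![1, 0; 0, -1]
  else
    if p.2 = 0 then !![0, 1; 1, 0] else !![0, -Complex.I; Complex.I, 0]

/-- Vectors of the Hilbert space of `n` qubits, in the computational basis. -/
abbrev Ket (n : ℕ) : Type := (Fin n → Fin 2) → ℂ

/-- The (Hermitian) operator of a Pauli: the tensor product of the single-qubit matrices. -/
noncomputable def pauliOp {n : ℕ} (p : Pauli n) : Matrix (Fin n → Fin 2) (Fin n → Fin 2) ℂ :=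
  Matrix.of fun y x => ∏ j, pauliMat (p j) (y j) (x j)

/-! ### Measurements and masking -/

/-- The projector `(1 + o m) / 2` on the eigenspace of `m` with eigenvalue `o = ± 1`. -/
noncomputable def measProj {n : ℕ} (m : Pauli n) (o : ℤˣ) :
    Matrix (Fin n → Fin 2) (Fin n → Fin 2) ℂ :=
  (1 / 2 : ℂ) • (1 + ((o : ℤ) : ℂ) • pauliOp m)

/-- The unnormalized state after successive measurements with the given outcomes. The record lists
the measured operators with their outcomes, first measurement first. By the Born rule the record
occurs with positive probability, when the initial state is `ψ`, iff the vector is nonzero. -/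
noncomputable def postState {n : ℕ} : List (Pauli n × ℤˣ) → Ket n → Ket n
  | [], ψ => ψ
  | (m, o) :: r, ψ => postState r (measProj m o *ᵥ ψ)

/-- Code states of the stabilizer code with generators `S i` and signs `σ i`. -/
def IsCodeState {n r : ℕ} (S : Fin r → Pauli n) (σ : Fin r → ℤˣ) (ψ : Ket n) : Prop :=
  ∀ i, pauliOp (S i) *ᵥ ψ = ((σ i : ℤ) : ℂ) • ψ

/-- The group `⟨S₀⟩`. -/
abbrev stabGroup {n r : ℕ} (S : Fin r → Pauli n) : Submodule (ZMod 2) (Pauli n) :=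
  Submodule.span (ZMod 2) (Set.range S)

/-- The syndrome of `s` can be obtained through the measurement sequence `ms`: there is a function
of the measurement record that, for an arbitrary (unknown) code state and an arbitrary (unknown)
Pauli error `E` in round `0`, gives the syndrome `E ⊙ s` on every record that occurs with positive
probability. -/
def Obtainable {n r : ℕ} (S : Fin r → Pauli n) (σ : Fin r → ℤˣ) (ms : List (Pauli n))
    (s : Pauli n) : Prop :=
  ∃ f : List (Pauli n × ℤˣ) → ZMod 2,
    ∀ ψ : Ket n, IsCodeState S σ ψ → ∀ E : Pauli n, ∀ rec : List (Pauli n × ℤˣ),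
      rec.map Prod.fst = ms → postState rec (pauliOp E *ᵥ ψ) ≠ 0 → f rec = symp E s

/-- `s` is an unmasked stabilizer of the round-`0` code for the sequence `ms`. -/
def IsUnmasked {n r : ℕ} (S : Fin r → Pauli n) (σ : Fin r → ℤˣ) (ms : List (Pauli n))
    (s : Pauli n) : Prop :=
  s ∈ stabGroup S ∧ Obtainable S σ ms s

/-- `s` is a temporarily masked stabilizer: its syndrome is not obtained through `ms`, but it is
obtained through some extension of `ms`. -/
def IsTemporarilyMasked {n r : ℕ} (S : Fin r → Pauli n) (σ : Fin r → ℤˣ) (ms : List (Pauli n))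
    (s : Pauli n) : Prop :=
  s ∈ stabGroup S ∧ ¬ Obtainable S σ ms s ∧ ∃ ext, Obtainable S σ (ms ++ ext) s

/-- `s` is a permanently masked stabilizer: its syndrome is obtained neither through `ms` nor
through any extension of `ms` by further measurements. -/
def IsPermanentlyMasked {n r : ℕ} (S : Fin r → Pauli n) (σ : Fin r → ℤˣ) (ms : List (Pauli n))
    (s : Pauli n) : Prop :=
  s ∈ stabGroup S ∧ ∀ ext, ¬ Obtainable S σ (ms ++ ext) s

/-! ### The distance algorithm -/

/-- The sets `C` and `V`. An element of `C` is a pair `(c, s_c)` of a Pauli operator and its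
associated stabilizer; elements with equal operators but different associated stabilizers are
different. -/
structure AlgState (n : ℕ) where
  C : Multiset (Pauli n × Pauli n)
  V : Multiset (Pauli n)

/-- Initially `C = S₀`, each generator being its own associated stabilizer, and `V` is empty. -/
def AlgState.init {n r : ℕ} (S : Fin r → Pauli n) : AlgState n where
  C := Finset.univ.val.map fun i => (S i, S i)
  V := 0

/-- Multiply by `v` each element of `V` that anti-commutes with `m`. -/
def updateV {n : ℕ} (m v : Pauli n) (V : Multiset (Pauli n)) : Multiset (Pauli n) :=
  V.map fun w => if symp w m = 1 then w + v else w

/-- Multiply by `x` each element `(c, s_c)` of `C` for which `c` anti-commutes with `m`. The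
associated stabilizer is multiplied by that of `x`. -/
def updateC {n : ℕ} (m : Pauli n) (x : Pauli n × Pauli n) (C : Multiset (Pauli n × Pauli n)) :
    Multiset (Pauli n × Pauli n) :=
  C.map fun y => if symp y.1 m = 1 then y + x else y

/-- `Step A m R B`: the measurement `m` may update the state `A` to `B`. The label `R` is
`some (c, s_c)` if `c`, with associated stabilizer `s_c`, is removed from `C` (Case 2), and `none`
in the other cases. The anti-commuting element to be removed is arbitrary. -/
inductive Step {n : ℕ} :
    AlgState n → Pauli n → Option (Pauli n × Pauli n) → AlgState n → Prop
  /-- Case 1, `m` not yet generated by `V`. -/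
  | case1_add (C : Multiset (Pauli n × Pauli n)) (V : Multiset (Pauli n)) (m : Pauli n)
      (hC : ∀ y ∈ C, symp y.1 m = 0) (hV : ∀ w ∈ V, symp w m = 0)
      (hm : m ∉ Submodule.span (ZMod 2) {w | w ∈ V}) :
      Step ⟨C, V⟩ m none ⟨C, m ::ₘ V⟩
  /-- Case 1, `m` already generated by `V`. -/
  | case1_keep (C : Multiset (Pauli n × Pauli n)) (V : Multiset (Pauli n)) (m : Pauli n)
      (hC : ∀ y ∈ C, symp y.1 m = 0) (hV : ∀ w ∈ V, symp w m = 0)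
      (hm : m ∈ Submodule.span (ZMod 2) {w | w ∈ V}) :
      Step ⟨C, V⟩ m none ⟨C, V⟩
  /-- Case 2: `m` anti-commutes with an element `x` of `C` and commutes with `V`. -/
  | case2 (C : Multiset (Pauli n × Pauli n)) (V : Multiset (Pauli n)) (m : Pauli n)
      (x : Pauli n × Pauli n) (hx : symp x.1 m = 1) (hV : ∀ w ∈ V, symp w m = 0) :
      Step ⟨x ::ₘ C, V⟩ m (some x) ⟨updateC m x C, m ::ₘ V⟩
  /-- Case 3: `m` commutes with `C` and anti-commutes with an element `v` of `V`. -/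
  | case3 (C : Multiset (Pauli n × Pauli n)) (V : Multiset (Pauli n)) (m : Pauli n)
      (v : Pauli n) (hC : ∀ y ∈ C, symp y.1 m = 0) (hv : symp v m = 1) :
      Step ⟨C, v ::ₘ V⟩ m none ⟨C, m ::ₘ updateV m v V⟩
  /-- Case 4: `m` anti-commutes with elements of both `C` and `V`. The associated stabilizers do
  not change. -/
  | case4 (C : Multiset (Pauli n × Pauli n)) (V : Multiset (Pauli n)) (m : Pauli n)
      (v : Pauli n) (hC : ∃ y ∈ C, symp y.1 m = 1) (hv : symp v m = 1) :
      Step ⟨C, v ::ₘ V⟩ m none ⟨updateC m (v, 0) C, m ::ₘ updateV m v V⟩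

/-- `Run A ms B`: processing the measurements `ms` in order may lead from `A` to `B`. -/
inductive Run {n : ℕ} : AlgState n → List (Pauli n) → AlgState n → Prop
  | nil (A : AlgState n) : Run A [] A
  | cons {A B D : AlgState n} {m : Pauli n} {ms : List (Pauli n)}
      {R : Option (Pauli n × Pauli n)} (h : Step A m R B) (h' : Run B ms D) : Run A (m :: ms) D

/-- The group `⟨C⟩`, whose elements carry their associated stabilizers. -/
def AlgState.groupC {n : ℕ} (A : AlgState n) : Submodule (ZMod 2) (Pauli n × Pauli n) :=
  Submodule.span (ZMod 2) {x | x ∈ A.C}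

/-- The group `⟨V⟩`. -/
def AlgState.groupV {n : ℕ} (A : AlgState n) : Submodule (ZMod 2) (Pauli n) :=
  Submodule.span (ZMod 2) {w | w ∈ A.V}

/-- `⟨C⟩ ∩ ⟨V⟩`: the elements of `⟨C⟩`, with their associated stabilizers, whose operator lies in
`⟨V⟩`. The identity operator may occur here with nontrivial associated stabilizers. -/
def AlgState.interCV {n : ℕ} (A : AlgState n) : Submodule (ZMod 2) (Pauli n × Pauli n) :=
  A.groupC ⊓ A.groupV.comap (LinearMap.fst (ZMod 2) (Pauli n) (Pauli n))

/-- The sets `U` and `T` are outputs of the algorithm at the final state `A`: `U` generates the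
group of stabilizers associated with the elements of `⟨C⟩ ∩ ⟨V⟩`, and `T` consists of the
stabilizers associated with the elements of `C` that do not lie in `⟨U⟩`. -/
structure IsOutput {n : ℕ} (A : AlgState n) (U T : Set (Pauli n)) : Prop where
  span_U : Submodule.span (ZMod 2) U =
    A.interCV.map (LinearMap.snd (ZMod 2) (Pauli n) (Pauli n))
  T_eq : T = {s | (∃ c, (c, s) ∈ A.C) ∧ s ∉ Submodule.span (ZMod 2) U}

end DynCode

open DynCode

/-! The proof follows a group `W` of pairs `(c, s)`: after a given record, the state has an
eigenvalue of `c` that is known up to the sign given by the syndrome of `s`. At the start `W` is the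
diagonal of `⟨S₀⟩` (`diagGroup`). Measuring `m` keeps the pairs whose operator commutes with `m` and
adjoins `(m, 0)` (`measUpdate`).

The syndrome of `s` is obtainable iff `(0, s) ∈ W` (`obtainable_iff`). If `(0, s) ∈ W`, the identity
has a known eigenvalue times the syndrome sign, and comparison with `1` reveals the sign. Otherwise
a linear form separates `(0, s)` from `W`; it consists of an error `E` and an operator `F` acting
after the measurements. `exists_pullback` moves `F` back to a Pauli `G` before them, and `E + G`
commutes with `S₀`. So one record is possible both for a code state without error and for another
code state with error `E`, although the syndromes of `s` differ.

The second projection of `W` (`recoverable`) never grows, and for `(c, s) ∈ W` measuring `c` gives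
`(0, s)`. Hence the permanently masked stabilizers are exactly those of `⟨S₀⟩` outside this
projection.

The algorithm keeps generators: `C` and `V × 0` together span `W` (`Run.groupCV_eq_of_init`), so the
projection is `⟨T⟩⟨U⟩`. The operators paired with `0` form exactly `⟨V⟩`, which is why a stabilizer
removed in Case 2 leaves the projection. -/

namespace DynCode

/-! ### Signs and the symplectic form -/

/-- The sign `(-1) ^ a`. -/
noncomputable def sgn (a : ZMod 2) : ℂ := if a = 0 then 1 else -1

lemma zmod_two_cases (a : ZMod 2) : a = 0 ∨ a = 1 := by
  revert a; decide

@[simp] lemma sgn_zero : sgn 0 = 1 := by simp [sgn]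

@[simp] lemma sgn_one : sgn 1 = -1 := by simp [sgn]

lemma sgn_add (a b : ZMod 2) : sgn (a + b) = sgn a * sgn b := by
  rcases zmod_two_cases a with rfl | rfl <;> rcases zmod_two_cases b with rfl | rfl <;>
    simp [CharTwo.add_self_eq_zero]

lemma sgn_sum {ι : Type*} (s : Finset ι) (f : ι → ZMod 2) :
    sgn (∑ i ∈ s, f i) = ∏ i ∈ s, sgn (f i) := by
  classical
  induction s using Finset.induction_on with
  | empty => simp
  | insert i s hi ih => rw [Finset.sum_insert hi, Finset.prod_insert hi, sgn_add, ih]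

lemma exists_sgn_mul_eq (u v : ℤˣ) : ∃ a : ZMod 2, sgn a * ((u : ℤ) : ℂ) = ((v : ℤ) : ℂ) := by
  rcases Int.units_eq_one_or u with rfl | rfl <;> rcases Int.units_eq_one_or v with rfl | rfl
  · exact ⟨0, by simp⟩
  · exact ⟨1, by simp⟩
  · exact ⟨1, by simp⟩
  · exact ⟨0, by simp⟩

variable {n r : ℕ}

lemma symp_comm (p q : Pauli n) : symp p q = symp q p := by
  unfold symp
  exact Finset.sum_congr rfl fun j _ => by ring

/-- The linear form `q ↦ q ⊙ m`. -/
def sympHom (m : Pauli n) : Pauli n →ₗ[ZMod 2] ZMod 2 where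
  toFun q := symp q m
  map_add' p q := by
    simp only [symp, ← Finset.sum_add_distrib]
    exact Finset.sum_congr rfl fun j _ => by simp; ring
  map_smul' c q := by
    simp only [symp, Finset.smul_sum, RingHom.id_apply]
    exact Finset.sum_congr rfl fun j _ => by simp; ring

@[simp] lemma sympHom_apply (m q : Pauli n) : sympHom m q = symp q m := rfl

@[simp] lemma symp_add_left (p q m : Pauli n) : symp (p + q) m = symp p m + symp q m :=
  (sympHom m).map_add p q

@[simp] lemma symp_zero_left (m : Pauli n) : symp 0 m = 0 := (sympHom m).map_zero

@[simp] lemma symp_add_right (m p q : Pauli n) : symp m (p + q) = symp m p + symp m q := by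
  simp only [symp_comm m, symp_add_left]

@[simp] lemma symp_self (p : Pauli n) : symp p p = 0 := by
  unfold symp
  refine Finset.sum_eq_zero fun j _ => ?_
  rw [mul_comm (p j).2]
  exact CharTwo.add_self_eq_zero _

/-- Nondegeneracy of the symplectic form. The form pairs `X`-parts with `Z`-parts, so the values of
`l` on the basis enter the witness swapped. -/
lemma exists_eq_sympHom (l : Pauli n →ₗ[ZMod 2] ZMod 2) : ∃ F, l = sympHom F := by
  refine ⟨fun j => (l (Pi.single j (0, 1)), l (Pi.single j (1, 0))), ?_⟩
  refine LinearMap.pi_ext fun j x => ?_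
  have hx : (Pi.single j x : Pauli n)
      = x.1 • (Pi.single j (1, 0) : Pauli n) + x.2 • (Pi.single j (0, 1) : Pauli n) := by
    rw [← Pi.single_smul, ← Pi.single_smul, ← Pi.single_add]
    simp
  have h : sympHom (fun j => (l (Pi.single j (0, 1)), l (Pi.single j (1, 0)))) (Pi.single j x)
      = x.1 * l (Pi.single j (1, 0)) + x.2 * l (Pi.single j (0, 1)) := by
    rw [sympHom_apply, symp, Finset.sum_eq_single j]
    · simp
    · intro b _ hb
      simp [Pi.single_eq_of_ne hb]
    · simp
  rw [h, hx, map_add, map_smul, map_smul, smul_eq_mul, smul_eq_mul]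

/-- By independence, `b` defines a linear form on the span of `S`; an extension to all Paulis is
symplectic by nondegeneracy. -/
lemma exists_symp_eq {S : Fin r → Pauli n} (hS : LinearIndependent (ZMod 2) S)
    (b : Fin r → ZMod 2) : ∃ E, ∀ i, symp (S i) E = b i := by
  obtain ⟨l, hl⟩ := LinearMap.exists_extend
    ((Finsupp.linearCombination (ZMod 2) b).comp hS.repr)
  obtain ⟨F, rfl⟩ := exists_eq_sympHom l
  refine ⟨F, fun i => ?_⟩
  have hi : S i ∈ Submodule.span (ZMod 2) (Set.range S) := Submodule.subset_span ⟨i, rfl⟩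
  have h := LinearMap.congr_fun hl ⟨S i, hi⟩
  simpa [hS.repr_eq_single i ⟨S i, hi⟩ rfl] using h

/-! ### Pauli matrices -/

lemma pauliMat_mul (p q : ZMod 2 × ZMod 2) :
    ∃ c : ℂ, c ≠ 0 ∧ pauliMat p * pauliMat q = c • pauliMat (p + q) := by
  have h11 : (1 : ZMod 2) + 1 = 0 := by decide
  obtain ⟨a, b⟩ := p
  obtain ⟨c, d⟩ := q
  have hI := Complex.I_ne_zero
  rcases zmod_two_cases a with rfl | rfl <;> rcases zmod_two_cases b with rfl | rfl <;>
  rcases zmod_two_cases c with rfl | rfl <;> rcases zmod_two_cases d with rfl | rfl <;>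
  -- The phase is `1`, `i` or `-i`; each alternative tries one of them.
  first
  | refine ⟨1, one_ne_zero, ?_⟩
    ext i j; fin_cases i <;> fin_cases j <;> simp [pauliMat, h11]
    done
  | refine ⟨Complex.I, hI, ?_⟩
    ext i j; fin_cases i <;> fin_cases j <;> simp [pauliMat, h11]
    done
  | refine ⟨-Complex.I, neg_ne_zero.2 hI, ?_⟩
    ext i j; fin_cases i <;> fin_cases j <;> simp [pauliMat, h11]

lemma pauliMat_mul_comm (p q : ZMod 2 × ZMod 2) :
    pauliMat p * pauliMat q = sgn (p.1 * q.2 + p.2 * q.1) • (pauliMat q * pauliMat p) := by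
  have h11 : (1 : ZMod 2) + 1 = 0 := by decide
  obtain ⟨a, b⟩ := p
  obtain ⟨c, d⟩ := q
  rcases zmod_two_cases a with rfl | rfl <;> rcases zmod_two_cases b with rfl | rfl <;>
  rcases zmod_two_cases c with rfl | rfl <;> rcases zmod_two_cases d with rfl | rfl <;>
  · ext i j; fin_cases i <;> fin_cases j <;> simp [pauliMat, h11]

lemma pauliMat_mul_self (p : ZMod 2 × ZMod 2) : pauliMat p * pauliMat p = 1 := by
  obtain ⟨a, b⟩ := p
  rcases zmod_two_cases a with rfl | rfl <;> rcases zmod_two_cases b with rfl | rfl <;>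
  · ext i j; fin_cases i <;> fin_cases j <;> simp [pauliMat]

/-- The tensor product of single-qubit matrices. -/
def tensorMat (A : Fin n → Matrix (Fin 2) (Fin 2) ℂ) :
    Matrix (Fin n → Fin 2) (Fin n → Fin 2) ℂ :=
  Matrix.of fun y x => ∏ j, A j (y j) (x j)

lemma tensorMat_mul (A B : Fin n → Matrix (Fin 2) (Fin 2) ℂ) :
    tensorMat A * tensorMat B = tensorMat fun j => A j * B j := by
  ext y x
  simp only [tensorMat, Matrix.mul_apply, Matrix.of_apply, ← Finset.prod_mul_distrib]
  rw [Finset.prod_univ_sum, Fintype.piFinset_univ]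

lemma tensorMat_smul (c : Fin n → ℂ) (A : Fin n → Matrix (Fin 2) (Fin 2) ℂ) :
    tensorMat (fun j => c j • A j) = (∏ j, c j) • tensorMat A := by
  ext y x
  simp [tensorMat, Finset.prod_mul_distrib]

lemma tensorMat_one : tensorMat (fun _ : Fin n => 1) = 1 := by
  ext y x
  rw [tensorMat, Matrix.of_apply]
  by_cases h : y = x
  · subst h; simp
  · obtain ⟨j, hj⟩ := Function.ne_iff.1 h
    rw [Matrix.one_apply_ne h]
    exact Finset.prod_eq_zero (Finset.mem_univ j) (Matrix.one_apply_ne hj)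

lemma pauliOp_eq_tensorMat (p : Pauli n) : pauliOp p = tensorMat fun j => pauliMat (p j) := rfl

lemma pauliOp_zero : pauliOp (0 : Pauli n) = 1 := by
  rw [pauliOp_eq_tensorMat, ← tensorMat_one]
  simp [pauliMat]

lemma pauliOp_mul (p q : Pauli n) :
    ∃ c : ℂ, c ≠ 0 ∧ pauliOp p * pauliOp q = c • pauliOp (p + q) := by
  choose c hc h using fun j => pauliMat_mul (p j) (q j)
  refine ⟨∏ j, c j, Finset.prod_ne_zero_iff.2 fun j _ => hc j, ?_⟩
  simp only [pauliOp_eq_tensorMat, tensorMat_mul, h, tensorMat_smul, Pi.add_apply]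

lemma pauliOp_mul_comm (p q : Pauli n) :
    pauliOp p * pauliOp q = sgn (symp p q) • (pauliOp q * pauliOp p) := by
  rw [pauliOp_eq_tensorMat, pauliOp_eq_tensorMat, tensorMat_mul, tensorMat_mul, symp, sgn_sum,
    ← tensorMat_smul]
  simp only [← pauliMat_mul_comm]

lemma pauliOp_mul_self (p : Pauli n) : pauliOp p * pauliOp p = 1 := by
  simp only [pauliOp_eq_tensorMat, tensorMat_mul, pauliMat_mul_self, tensorMat_one]

lemma pauliOp_add_mulVec (p q : Pauli n) :
    ∃ c : ℂ, c ≠ 0 ∧ ∀ ψ, pauliOp (p + q) *ᵥ ψ = c • (pauliOp p *ᵥ (pauliOp q *ᵥ ψ)) := by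
  obtain ⟨c, hc, h⟩ := pauliOp_mul p q
  refine ⟨c⁻¹, inv_ne_zero hc, fun ψ => ?_⟩
  rw [Matrix.mulVec_mulVec, h, Matrix.smul_mulVec, smul_smul, inv_mul_cancel₀ hc, one_smul]

lemma pauliOp_mulVec_comm (p q : Pauli n) (ψ : Ket n) :
    pauliOp p *ᵥ (pauliOp q *ᵥ ψ) = sgn (symp p q) • (pauliOp q *ᵥ (pauliOp p *ᵥ ψ)) := by
  rw [Matrix.mulVec_mulVec, pauliOp_mul_comm, Matrix.smul_mulVec, Matrix.mulVec_mulVec]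

lemma pauliOp_mulVec_self (p : Pauli n) (ψ : Ket n) :
    pauliOp p *ᵥ (pauliOp p *ᵥ ψ) = ψ := by
  rw [Matrix.mulVec_mulVec, pauliOp_mul_self, Matrix.one_mulVec]

lemma pauliOp_mulVec_ne_zero (p : Pauli n) {ψ : Ket n} (h : ψ ≠ 0) : pauliOp p *ᵥ ψ ≠ 0 := by
  intro h0
  apply h
  rw [← pauliOp_mulVec_self p ψ, h0, Matrix.mulVec_zero]

/-! ### Measurement projectors and records of positive probability -/

lemma measProj_mulVec (m : Pauli n) (o : ℤˣ) (ψ : Ket n) :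
    measProj m o *ᵥ ψ = (1 / 2 : ℂ) • (ψ + ((o : ℤ) : ℂ) • (pauliOp m *ᵥ ψ)) := by
  rw [measProj, Matrix.smul_mulVec, Matrix.add_mulVec, Matrix.one_mulVec, Matrix.smul_mulVec]

lemma units_cast_mul_self (o : ℤˣ) : ((o : ℤ) : ℂ) * ((o : ℤ) : ℂ) = 1 := by
  rcases Int.units_eq_one_or o with rfl | rfl <;> simp

lemma units_cast_ne_zero (o : ℤˣ) : ((o : ℤ) : ℂ) ≠ 0 := by
  intro h
  simpa [h] using units_cast_mul_self o

lemma pauliOp_measProj (m : Pauli n) (o : ℤˣ) (ψ : Ket n) :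
    pauliOp m *ᵥ (measProj m o *ᵥ ψ) = ((o : ℤ) : ℂ) • (measProj m o *ᵥ ψ) := by
  simp only [measProj_mulVec, Matrix.mulVec_smul, Matrix.mulVec_add, pauliOp_mulVec_self,
    smul_add, smul_smul]
  rw [mul_left_comm, units_cast_mul_self, mul_one, mul_comm, add_comm]

lemma measProj_pauliOp (m : Pauli n) (o : ℤˣ) (ψ : Ket n) :
    measProj m o *ᵥ (pauliOp m *ᵥ ψ) = ((o : ℤ) : ℂ) • (measProj m o *ᵥ ψ) := by
  simp only [measProj_mulVec, pauliOp_mulVec_self, smul_add, smul_smul]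
  rw [mul_left_comm, units_cast_mul_self, mul_one, mul_comm, add_comm]

lemma pauliOp_measProj_comm {c m : Pauli n} (h : symp c m = 0) (o : ℤˣ) (ψ : Ket n) :
    pauliOp c *ᵥ (measProj m o *ᵥ ψ) = measProj m o *ᵥ (pauliOp c *ᵥ ψ) := by
  simp only [measProj_mulVec, Matrix.mulVec_smul, Matrix.mulVec_add, pauliOp_mulVec_comm c m, h,
    sgn_zero, one_smul]

/-- The projectors of the two outcomes sum to the identity. -/
lemma exists_measProj_ne_zero (m : Pauli n) {ψ : Ket n} (h : ψ ≠ 0) :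
    ∃ o, measProj m o *ᵥ ψ ≠ 0 := by
  by_contra! H
  apply h
  have h1 := H 1
  have h2 := H (-1)
  have h3 : ψ = measProj m 1 *ᵥ ψ + measProj m (-1) *ᵥ ψ := by
    simp only [measProj_mulVec]
    ext x
    simp
    ring
  rw [h3, h1, h2, add_zero]

lemma postState_smul (rec : List (Pauli n × ℤˣ)) (c : ℂ) (ψ : Ket n) :
    postState rec (c • ψ) = c • postState rec ψ := by
  induction rec generalizing ψ with
  | nil => rfl
  | cons x rec ih => rw [postState, Matrix.mulVec_smul, ih, postState]

lemma exists_postState_ne_zero (ms : List (Pauli n)) {ψ : Ket n} (h : ψ ≠ 0) :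
    ∃ rec : List (Pauli n × ℤˣ), rec.map Prod.fst = ms ∧ postState rec ψ ≠ 0 := by
  induction ms generalizing ψ with
  | nil => exact ⟨[], rfl, h⟩
  | cons m ms ih =>
    obtain ⟨o, ho⟩ := exists_measProj_ne_zero m h
    obtain ⟨rec, rfl, hrec⟩ := ih ho
    exact ⟨(m, o) :: rec, rfl, hrec⟩

/-! ### The group of operators with known eigenvalues -/

/-- The effect of measuring `m` on a group `W` of stabilizers with associated stabilizers: only the
elements that commute with `m` survive, and `m` is added with trivial associated stabilizer. -/
def measUpdate (W : Submodule (ZMod 2) (Pauli n × Pauli n)) (m : Pauli n) :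
    Submodule (ZMod 2) (Pauli n × Pauli n) :=
  W ⊓ LinearMap.ker ((sympHom m).comp (LinearMap.fst (ZMod 2) (Pauli n) (Pauli n))) ⊔
    Submodule.span (ZMod 2) {(m, 0)}

/-- The effect of measuring `m` on a group `V` of stabilizers. -/
def measUpdateV (V : Submodule (ZMod 2) (Pauli n)) (m : Pauli n) :
    Submodule (ZMod 2) (Pauli n) :=
  V ⊓ LinearMap.ker (sympHom m) ⊔ Submodule.span (ZMod 2) {m}

lemma mem_measUpdate {W : Submodule (ZMod 2) (Pauli n × Pauli n)} {m : Pauli n}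
    {w : Pauli n × Pauli n} :
    w ∈ measUpdate W m ↔
      ∃ y ∈ W, symp y.1 m = 0 ∧ ∃ a : ZMod 2, w = y + a • (m, 0) := by
  simp only [measUpdate, Submodule.mem_sup, Submodule.mem_inf, LinearMap.mem_ker,
    LinearMap.comp_apply, LinearMap.fst_apply, sympHom_apply, Submodule.mem_span_singleton]
  constructor
  · rintro ⟨y, ⟨hy, h0⟩, _, ⟨a, rfl⟩, rfl⟩
    exact ⟨y, hy, h0, a, rfl⟩
  · rintro ⟨y, hy, h0, a, rfl⟩
    exact ⟨y, ⟨hy, h0⟩, _, ⟨a, rfl⟩, rfl⟩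

lemma mem_measUpdateV {V : Submodule (ZMod 2) (Pauli n)} {m w : Pauli n} :
    w ∈ measUpdateV V m ↔ ∃ y ∈ V, symp y m = 0 ∧ ∃ a : ZMod 2, w = y + a • m := by
  simp only [measUpdateV, Submodule.mem_sup, Submodule.mem_inf, LinearMap.mem_ker,
    sympHom_apply, Submodule.mem_span_singleton]
  constructor
  · rintro ⟨y, ⟨hy, h0⟩, _, ⟨a, rfl⟩, rfl⟩
    exact ⟨y, hy, h0, a, rfl⟩
  · rintro ⟨y, hy, h0, a, rfl⟩
    exact ⟨y, ⟨hy, h0⟩, _, ⟨a, rfl⟩, rfl⟩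

lemma mem_measUpdate_self (W : Submodule (ZMod 2) (Pauli n × Pauli n)) (m : Pauli n) :
    (m, 0) ∈ measUpdate W m :=
  mem_measUpdate.2 ⟨0, W.zero_mem, symp_zero_left m, 1, by simp⟩

lemma mem_measUpdate_of_symp {W : Submodule (ZMod 2) (Pauli n × Pauli n)} {m : Pauli n}
    {w : Pauli n × Pauli n} (hw : w ∈ W) (h : symp w.1 m = 0) : w ∈ measUpdate W m :=
  mem_measUpdate.2 ⟨w, hw, h, 0, by simp⟩

/-- Since `m` enters with trivial associated stabilizer, the operators paired with `0` evolve by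
themselves, under the same rule as `⟨V⟩`. -/
lemma comap_inl_measUpdate (W : Submodule (ZMod 2) (Pauli n × Pauli n)) (m : Pauli n) :
    (measUpdate W m).comap (LinearMap.inl (ZMod 2) (Pauli n) (Pauli n)) =
      measUpdateV (W.comap (LinearMap.inl (ZMod 2) (Pauli n) (Pauli n))) m := by
  ext w
  simp only [Submodule.mem_comap, LinearMap.inl_apply, mem_measUpdate, mem_measUpdateV]
  constructor
  · rintro ⟨⟨y, t⟩, hy, h0, a, h⟩
    have ht : t = 0 := by simpa using (congrArg Prod.snd h).symm
    subst ht
    exact ⟨y, hy, h0, a, by simpa using congrArg Prod.fst h⟩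
  · rintro ⟨y, hy, h0, a, rfl⟩
    exact ⟨(y, 0), hy, h0, a, by simp⟩

/-- The new pair `(m, 0)` adds nothing to the second projection, so a lost stabilizer never returns.
-/
lemma map_snd_measUpdate_le (W : Submodule (ZMod 2) (Pauli n × Pauli n)) (m : Pauli n) :
    (measUpdate W m).map (LinearMap.snd (ZMod 2) (Pauli n) (Pauli n)) ≤
      W.map (LinearMap.snd (ZMod 2) (Pauli n) (Pauli n)) := by
  rintro _ ⟨w, hw, rfl⟩
  obtain ⟨y, hy, -, a, rfl⟩ := mem_measUpdate.1 hw
  exact ⟨y, hy, by simp⟩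

lemma map_snd_foldl_measUpdate_le (W : Submodule (ZMod 2) (Pauli n × Pauli n))
    (ms : List (Pauli n)) :
    (ms.foldl measUpdate W).map (LinearMap.snd (ZMod 2) (Pauli n) (Pauli n)) ≤
      W.map (LinearMap.snd (ZMod 2) (Pauli n) (Pauli n)) := by
  induction ms generalizing W with
  | nil => exact le_rfl
  | cons m ms ih => exact (ih _).trans (map_snd_measUpdate_le W m)

lemma comap_inl_foldl_measUpdate (W : Submodule (ZMod 2) (Pauli n × Pauli n))
    (ms : List (Pauli n)) :
    (ms.foldl measUpdate W).comap (LinearMap.inl (ZMod 2) (Pauli n) (Pauli n)) =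
      ms.foldl measUpdateV (W.comap (LinearMap.inl (ZMod 2) (Pauli n) (Pauli n))) := by
  induction ms generalizing W with
  | nil => rfl
  | cons m ms ih => rw [List.foldl_cons, List.foldl_cons, ih, comap_inl_measUpdate]

/-- Operators in `W` keep, on the states that go through a measurement record, an eigenvalue that
depends only on the record and on the character `χ` of the associated stabilizer. -/
lemma eigenvalue_postState {ι : Type*} (χ : ι → Pauli n → ℂ) (rec : List (Pauli n × ℤˣ))
    {W : Submodule (ZMod 2) (Pauli n × Pauli n)} {Φ : ι → Ket n}
    (h : ∀ w ∈ W, ∃ g : ℂ, ∀ i, pauliOp w.1 *ᵥ Φ i = (g * χ i w.2) • Φ i) :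
    ∀ w ∈ (rec.map Prod.fst).foldl measUpdate W,
      ∃ g : ℂ, ∀ i, pauliOp w.1 *ᵥ postState rec (Φ i) = (g * χ i w.2) • postState rec (Φ i) := by
  induction rec generalizing W Φ with
  | nil => exact h
  | cons x rec ih =>
    obtain ⟨m, o⟩ := x
    refine ih fun w hw => ?_
    obtain ⟨y, hy, hym, a, rfl⟩ := mem_measUpdate.1 hw
    obtain ⟨g, hg⟩ := h y hy
    have hy' : ∀ i, pauliOp y.1 *ᵥ (measProj m o *ᵥ Φ i)
        = (g * χ i y.2) • (measProj m o *ᵥ Φ i) := fun i => by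
      rw [pauliOp_measProj_comm hym, hg, Matrix.mulVec_smul]
    rcases zmod_two_cases a with rfl | rfl
    · exact ⟨g, fun i => by simpa using hy' i⟩
    -- The phase of the product and the outcome `o` do not depend on the state, so both are absorbed
    -- into `g`.
    · obtain ⟨c, -, hc⟩ := pauliOp_add_mulVec y.1 m
      refine ⟨c * ((o : ℤ) : ℂ) * g, fun i => ?_⟩
      have e1 : (y + (1 : ZMod 2) • (m, (0 : Pauli n))).1 = y.1 + m := by simp
      have e2 : (y + (1 : ZMod 2) • (m, (0 : Pauli n))).2 = y.2 := by simp
      rw [e1, e2, hc, pauliOp_measProj, Matrix.mulVec_smul, hy', smul_smul, smul_smul]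
      congr 1
      ring

/-- An operator `F` after the measurements that agrees with the error `E` on the final group can be
pulled back through the measurement record. -/
lemma exists_pullback (E F : Pauli n) (ms : List (Pauli n))
    {W : Submodule (ZMod 2) (Pauli n × Pauli n)}
    (h : ∀ w ∈ ms.foldl measUpdate W, symp w.1 F = symp w.2 E) :
    ∃ G : Pauli n, (∀ w ∈ W, symp w.1 G = symp w.2 E) ∧
      ∀ rec : List (Pauli n × ℤˣ), rec.map Prod.fst = ms → ∀ ψ : Ket n, ∃ c : ℂ, c ≠ 0 ∧
        postState rec (pauliOp G *ᵥ ψ) = c • (pauliOp F *ᵥ postState rec ψ) := by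
  induction ms generalizing W with
  | nil =>
    refine ⟨F, h, fun rec hrec ψ => ⟨1, one_ne_zero, ?_⟩⟩
    rw [List.map_eq_nil_iff] at hrec
    subst hrec
    rw [one_smul]; rfl
  | cons m ms ih =>
    obtain ⟨G, hG, hpost⟩ := ih h
    -- The pair `(m, 0)` lies in the updated group, which forces `G` to commute with `m` and hence
    -- to pass through the projector.
    have hGm : symp G m = 0 := by
      rw [symp_comm]
      simpa using hG _ (mem_measUpdate_self W m)
    have hcomm : ∀ w ∈ W, symp w.1 m = 0 → symp w.1 G = symp w.2 E := fun w hw hwm =>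
      hG w (mem_measUpdate_of_symp hw hwm)
    by_cases hall : ∀ w ∈ W, symp w.1 G = symp w.2 E
    · refine ⟨G, hall, fun rec' hrec' ψ => ?_⟩
      obtain ⟨x, rec, rfl, rfl, hrec⟩ := List.map_eq_cons_iff.1 hrec'
      obtain ⟨c, hc, hpost⟩ := hpost rec hrec (measProj x.1 x.2 *ᵥ ψ)
      refine ⟨c, hc, ?_⟩
      rw [postState, postState, ← hpost, pauliOp_measProj_comm hGm]
    · push Not at hall
      obtain ⟨z, hz, hzG⟩ := hall
      have one_of_ne : ∀ a : ZMod 2, a ≠ 0 → a = 1 := by decide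
      have hzm : symp z.1 m = 1 := one_of_ne _ fun h0 => hzG (hcomm z hz h0)
      -- The discrepancy `w.1 ⊙ G + w.2 ⊙ E` vanishes on the part of `W` commuting with `m`, but not
      -- on `z`, so on `W` it equals `w.1 ⊙ m`. The factor `m` cancels it, and the projector turns
      -- that factor into the scalar `± 1`.
      refine ⟨G + m, fun w hw => ?_, fun rec' hrec' ψ => ?_⟩
      · rw [symp_add_right]
        rcases zmod_two_cases (symp w.1 m) with h0 | h1
        · rw [h0, add_zero, hcomm w hw h0]
        · have hwz := hcomm (w + z) (W.add_mem hw hz) (by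
            rw [Prod.fst_add, symp_add_left, h1, hzm]; decide)
          rw [Prod.fst_add, Prod.snd_add, symp_add_left, symp_add_left] at hwz
          rw [h1]
          have key : ∀ a b c d : ZMod 2, a + b = c + d → b ≠ d → a + 1 = c := by decide
          exact key _ _ _ _ hwz hzG
      · obtain ⟨x, rec, rfl, rfl, hrec⟩ := List.map_eq_cons_iff.1 hrec'
        obtain ⟨c, hc, hpost⟩ := hpost rec hrec (measProj x.1 x.2 *ᵥ ψ)
        obtain ⟨d, hd, hadd⟩ := pauliOp_add_mulVec G x.1
        refine ⟨d * ((x.2 : ℤ) : ℂ) * c,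
          mul_ne_zero (mul_ne_zero hd (units_cast_ne_zero x.2)) hc, ?_⟩
        rw [postState, postState, hadd, Matrix.mulVec_smul, ← pauliOp_measProj_comm hGm,
          measProj_pauliOp, Matrix.mulVec_smul, smul_smul, postState_smul, hpost, smul_smul]

/-! ### Code states -/

/-- Projecting onto an eigenspace of `m` preserves the eigenvalues of operators commuting with `m`.
-/
lemma exists_eigenstate (ms : List (Pauli n)) (hcomm : ∀ p ∈ ms, ∀ q ∈ ms, symp p q = 0) :
    ∃ ψ : Ket n, ψ ≠ 0 ∧ ∀ p ∈ ms, ∃ o : ℤˣ, pauliOp p *ᵥ ψ = ((o : ℤ) : ℂ) • ψ := by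
  induction ms with
  | nil => exact ⟨fun _ => 1, fun h => one_ne_zero (congrFun h fun _ => 0), by simp⟩
  | cons m ms ih =>
    obtain ⟨ψ, hψ, h⟩ := ih fun p hp q hq =>
      hcomm p (List.mem_cons_of_mem _ hp) q (List.mem_cons_of_mem _ hq)
    obtain ⟨o, ho⟩ := exists_measProj_ne_zero m hψ
    refine ⟨_, ho, fun p hp => ?_⟩
    rcases List.mem_cons.1 hp with rfl | hp'
    · exact ⟨o, pauliOp_measProj p o ψ⟩
    · obtain ⟨u, hu⟩ := h p hp'
      exact ⟨u, by rw [pauliOp_measProj_comm (hcomm p hp m List.mem_cons_self), hu,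
        Matrix.mulVec_smul]⟩

lemma exists_isCodeState_ne_zero {S : Fin r → Pauli n} (σ : Fin r → ℤˣ)
    (hS : LinearIndependent (ZMod 2) S) (hcomm : ∀ i j, symp (S i) (S j) = 0) :
    ∃ ψ : Ket n, ψ ≠ 0 ∧ IsCodeState S σ ψ := by
  obtain ⟨ψ, hψ, h⟩ := exists_eigenstate (List.ofFn S) (by
    intro p hp q hq
    obtain ⟨i, rfl⟩ := (List.mem_ofFn' _ _).1 hp
    obtain ⟨j, rfl⟩ := (List.mem_ofFn' _ _).1 hq
    exact hcomm i j)
  choose o ho using fun i => h (S i) ((List.mem_ofFn' _ _).2 ⟨i, rfl⟩)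
  choose b hb using fun i => exists_sgn_mul_eq (o i) (σ i)
  -- The common eigenstate may have wrong signs; `E` anti-commutes exactly with the generators whose
  -- sign must be flipped.
  obtain ⟨E, hE⟩ := exists_symp_eq hS b
  refine ⟨pauliOp E *ᵥ ψ, pauliOp_mulVec_ne_zero E hψ, fun i => ?_⟩
  rw [pauliOp_mulVec_comm, hE, ho, Matrix.mulVec_smul, smul_smul, hb]

lemma IsCodeState.pauliOp_mulVec {S : Fin r → Pauli n} {σ : Fin r → ℤˣ} {ψ : Ket n}
    (h : IsCodeState S σ ψ) {L : Pauli n} (hL : ∀ i, symp (S i) L = 0) :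
    IsCodeState S σ (pauliOp L *ᵥ ψ) := fun i => by
  rw [pauliOp_mulVec_comm, hL, h i, Matrix.mulVec_smul, sgn_zero, one_smul]

/-- The initial group: each stabilizer is its own associated stabilizer. -/
def diagGroup (S : Fin r → Pauli n) : Submodule (ZMod 2) (Pauli n × Pauli n) :=
  Submodule.span (ZMod 2) (Set.range fun i => (S i, S i))

lemma mem_diagGroup {S : Fin r → Pauli n} {w : Pauli n × Pauli n} :
    w ∈ diagGroup S ↔ w.1 ∈ stabGroup S ∧ w.1 = w.2 := by
  have h : diagGroup S = (stabGroup S).map (LinearMap.id.prod LinearMap.id) := by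
    rw [diagGroup, stabGroup, Submodule.map_span, ← Set.range_comp]
    rfl
  rw [h]
  constructor
  · rintro ⟨x, hx, rfl⟩
    exact ⟨hx, rfl⟩
  · rintro ⟨h1, h2⟩
    exact ⟨w.1, h1, Prod.ext rfl h2⟩

lemma map_snd_diagGroup (S : Fin r → Pauli n) :
    (diagGroup S).map (LinearMap.snd (ZMod 2) (Pauli n) (Pauli n)) = stabGroup S := by
  ext s
  constructor
  · rintro ⟨w, hw, rfl⟩
    obtain ⟨h1, h2⟩ := mem_diagGroup.1 hw
    rw [LinearMap.snd_apply, ← h2]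
    exact h1
  · intro hs
    exact ⟨(s, s), mem_diagGroup.2 ⟨hs, rfl⟩, rfl⟩

lemma comap_inl_diagGroup (S : Fin r → Pauli n) :
    (diagGroup S).comap (LinearMap.inl (ZMod 2) (Pauli n) (Pauli n)) = ⊥ := by
  rw [eq_bot_iff]
  intro w hw
  exact (mem_diagGroup.1 hw).2

/-- Elements of the code's stabilizer group act as scalars on the code space. -/
lemma IsCodeState.exists_eigenvalue (S : Fin r → Pauli n) (σ : Fin r → ℤˣ) {p : Pauli n}
    (hp : p ∈ stabGroup S) :
    ∃ g : ℂ, ∀ ψ : Ket n, IsCodeState S σ ψ → pauliOp p *ᵥ ψ = g • ψ := by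
  induction hp using Submodule.span_induction with
  | mem x hx =>
    obtain ⟨i, rfl⟩ := hx
    exact ⟨_, fun ψ hψ => hψ i⟩
  | zero => exact ⟨1, fun ψ _ => by rw [pauliOp_zero, Matrix.one_mulVec, one_smul]⟩
  | add x y _ _ hx hy =>
    obtain ⟨a, ha⟩ := hx
    obtain ⟨b, hb⟩ := hy
    obtain ⟨c, -, hc⟩ := pauliOp_add_mulVec x y
    exact ⟨c * (b * a), fun ψ hψ => by
      rw [hc, hb ψ hψ, Matrix.mulVec_smul, ha ψ hψ, smul_smul, smul_smul, mul_assoc]⟩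
  | smul a x _ hx =>
    rcases zmod_two_cases a with rfl | rfl
    · exact ⟨1, fun ψ _ => by rw [zero_smul, pauliOp_zero, Matrix.one_mulVec, one_smul]⟩
    · simpa using hx

/-! ### Characterization of masking -/

/-- After a measurement record, the operators in the final group have on the code states with error
`E` an eigenvalue that depends only on the record and on the syndrome of the associated
stabilizer. -/
lemma exists_eigenvalue_postState_error (S : Fin r → Pauli n) (σ : Fin r → ℤˣ)
    (rec : List (Pauli n × ℤˣ)) {w : Pauli n × Pauli n}
    (hw : w ∈ (rec.map Prod.fst).foldl measUpdate (diagGroup S)) :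
    ∃ g : ℂ, ∀ ψ : Ket n, IsCodeState S σ ψ → ∀ E : Pauli n,
      pauliOp w.1 *ᵥ postState rec (pauliOp E *ᵥ ψ) =
        (g * sgn (symp w.2 E)) • postState rec (pauliOp E *ᵥ ψ) := by
  have h0 : ∀ w ∈ diagGroup S, ∃ g : ℂ, ∀ i : {ψ : Ket n // IsCodeState S σ ψ} × Pauli n,
      pauliOp w.1 *ᵥ (pauliOp i.2 *ᵥ i.1.1) =
        (g * sgn (symp w.2 i.2)) • (pauliOp i.2 *ᵥ i.1.1) := fun w hw => by
    obtain ⟨h1, h2⟩ := mem_diagGroup.1 hw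
    obtain ⟨g, hg⟩ := IsCodeState.exists_eigenvalue S σ h1
    refine ⟨g, fun i => ?_⟩
    rw [pauliOp_mulVec_comm, hg _ i.1.2, Matrix.mulVec_smul, smul_smul, h2, mul_comm]
  obtain ⟨g, hg⟩ := eigenvalue_postState
    (fun (i : {ψ : Ket n // IsCodeState S σ ψ} × Pauli n) t => sgn (symp t i.2)) rec h0 w hw
  exact ⟨g, fun ψ hψ E => hg (⟨ψ, hψ⟩, E)⟩

lemma obtainable_of_mem {S : Fin r → Pauli n} (σ : Fin r → ℤˣ) {ms : List (Pauli n)}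
    {s : Pauli n} (hs : (0, s) ∈ ms.foldl measUpdate (diagGroup S)) : Obtainable S σ ms s := by
  classical
  have key : ∀ rec : List (Pauli n × ℤˣ), ∃ g : ℂ, rec.map Prod.fst = ms →
      ∀ ψ : Ket n, IsCodeState S σ ψ → ∀ E : Pauli n,
        pauliOp (0 : Pauli n) *ᵥ postState rec (pauliOp E *ᵥ ψ)
          = (g * sgn (symp s E)) • postState rec (pauliOp E *ᵥ ψ) := fun rec => by
    by_cases h : rec.map Prod.fst = ms
    · obtain ⟨g, hg⟩ := exists_eigenvalue_postState_error S σ rec (w := (0, s)) (by rwa [h])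
      exact ⟨g, fun _ => hg⟩
    · exact ⟨0, fun h' => absurd h' h⟩
  choose g hg using key
  -- The identity has eigenvalue `1` on a nonzero state, so `g rec` is itself the syndrome sign.
  refine ⟨fun rec => if g rec = 1 then 0 else 1, fun ψ hψ E rec hrec hne => ?_⟩
  have h := hg rec hrec ψ hψ E
  rw [pauliOp_zero, Matrix.one_mulVec] at h
  have h1 : g rec * sgn (symp s E) = 1 := by
    have h0 : (1 - g rec * sgn (symp s E)) • postState rec (pauliOp E *ᵥ ψ) = 0 := by
      rw [sub_smul, one_smul, ← h, sub_self]
    rcases smul_eq_zero.1 h0 with h0 | h0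
    · exact (sub_eq_zero.1 h0).symm
    · exact absurd h0 hne
  rw [symp_comm E s]
  rcases zmod_two_cases (symp s E) with h2 | h2
  · rw [h2, sgn_zero, mul_one] at h1
    simp only [h2, if_pos h1]
  · rw [h2, sgn_one] at h1
    refine (if_neg ?_).trans h2.symm
    intro h3
    rw [h3] at h1
    norm_num at h1

/-- Indistinguishability argument: a form separating `(0, s)` from the final group yields two code
states and two errors that share a possible record but give different syndromes of `s`. -/
lemma mem_of_obtainable {S : Fin r → Pauli n} {σ : Fin r → ℤˣ}
    (hS : LinearIndependent (ZMod 2) S) (hcomm : ∀ i j, symp (S i) (S j) = 0)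
    {ms : List (Pauli n)} {s : Pauli n} (hs : Obtainable S σ ms s) :
    (0, s) ∈ ms.foldl measUpdate (diagGroup S) := by
  by_contra hmem
  obtain ⟨l, hl, hle⟩ := Submodule.exists_le_ker_of_notMem hmem
  obtain ⟨F, hF⟩ := exists_eq_sympHom (l.comp (LinearMap.inl (ZMod 2) (Pauli n) (Pauli n)))
  obtain ⟨E, hE⟩ := exists_eq_sympHom (l.comp (LinearMap.inr (ZMod 2) (Pauli n) (Pauli n)))
  have hl' : ∀ w : Pauli n × Pauli n, l w = symp w.1 F + symp w.2 E := fun w => by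
    have h1 := LinearMap.congr_fun hF w.1
    have h2 := LinearMap.congr_fun hE w.2
    simp only [LinearMap.comp_apply, LinearMap.inl_apply, LinearMap.inr_apply,
      sympHom_apply] at h1 h2
    rw [← h1, ← h2, ← map_add, Prod.mk_add_mk, add_zero, zero_add]
  obtain ⟨G, hG, hpost⟩ := exists_pullback E F ms (W := diagGroup S) fun w hw => by
    have h0 : l w = 0 := hle hw
    rw [hl'] at h0
    exact CharTwo.add_eq_zero.1 h0
  -- `G` and `E` have the same syndromes, so `E + G` preserves the code space, and `G` acts on `ψ`
  -- as the error `E` on the code state `(E + G) ψ`, up to phase.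
  have hL : ∀ i, symp (S i) (E + G) = 0 := fun i => by
    rw [symp_add_right, hG (S i, S i) (Submodule.subset_span ⟨i, rfl⟩)]
    exact CharTwo.add_self_eq_zero _
  obtain ⟨ψ, hψ, hcode⟩ := exists_isCodeState_ne_zero σ hS hcomm
  obtain ⟨rec, hrec, hne⟩ := exists_postState_ne_zero ms hψ
  obtain ⟨f, hf⟩ := hs
  have f0 := hf ψ hcode 0 rec hrec (by rwa [pauliOp_zero, Matrix.one_mulVec])
  obtain ⟨c, hc, hpost⟩ := hpost rec hrec ψ
  obtain ⟨d, hd, hadd⟩ := pauliOp_add_mulVec E (E + G)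
  have hEG : E + (E + G) = G := by
    rw [← add_assoc, ZModModule.add_self, zero_add]
  have f1 := hf _ (hcode.pauliOp_mulVec hL) E rec hrec (by
    intro h0
    have h1 := congrArg (d • ·) h0
    simp only [smul_zero] at h1
    rw [← postState_smul, ← hadd, hEG, hpost] at h1
    exact smul_ne_zero hc (pauliOp_mulVec_ne_zero F hne) h1)
  rw [f0, symp_zero_left, symp_comm] at f1
  apply hl
  rw [hl', ← f1, symp_zero_left, add_zero]

lemma obtainable_iff {S : Fin r → Pauli n} {σ : Fin r → ℤˣ}
    (hS : LinearIndependent (ZMod 2) S) (hcomm : ∀ i j, symp (S i) (S j) = 0)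
    {ms : List (Pauli n)} {s : Pauli n} :
    Obtainable S σ ms s ↔ (0, s) ∈ ms.foldl measUpdate (diagGroup S) :=
  ⟨mem_of_obtainable hS hcomm, obtainable_of_mem σ⟩

/-- The stabilizers whose syndrome can still be obtained. -/
def recoverable (S : Fin r → Pauli n) (ms : List (Pauli n)) : Submodule (ZMod 2) (Pauli n) :=
  (ms.foldl measUpdate (diagGroup S)).map (LinearMap.snd (ZMod 2) (Pauli n) (Pauli n))

lemma recoverable_le_stabGroup (S : Fin r → Pauli n) (ms : List (Pauli n)) :
    recoverable S ms ≤ stabGroup S :=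
  (map_snd_foldl_measUpdate_le _ ms).trans_eq (map_snd_diagGroup S)

lemma exists_obtainable_iff {S : Fin r → Pauli n} {σ : Fin r → ℤˣ}
    (hS : LinearIndependent (ZMod 2) S) (hcomm : ∀ i j, symp (S i) (S j) = 0)
    {ms : List (Pauli n)} {s : Pauli n} :
    (∃ ext, Obtainable S σ (ms ++ ext) s) ↔ s ∈ recoverable S ms := by
  constructor
  · rintro ⟨ext, h⟩
    rw [obtainable_iff hS hcomm, List.foldl_append] at h
    exact map_snd_foldl_measUpdate_le _ ext ⟨_, h, rfl⟩
  · rintro ⟨⟨c, s⟩, hw, rfl⟩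
    -- Measuring `c` itself keeps `(c, s)` and adds `(c, 0)`; their sum is `(0, s)`.
    refine ⟨[c], (obtainable_iff hS hcomm).2 ?_⟩
    rw [List.foldl_append, List.foldl_cons, List.foldl_nil, LinearMap.snd_apply]
    have h := Submodule.add_mem _ (mem_measUpdate_of_symp (m := c) hw (symp_self c))
      (mem_measUpdate_self (ms.foldl measUpdate (diagGroup S)) c)
    rwa [Prod.mk_add_mk, ZModModule.add_self, add_zero] at h

lemma isPermanentlyMasked_iff {S : Fin r → Pauli n} {σ : Fin r → ℤˣ}
    (hS : LinearIndependent (ZMod 2) S) (hcomm : ∀ i j, symp (S i) (S j) = 0)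
    {ms : List (Pauli n)} {s : Pauli n} :
    IsPermanentlyMasked S σ ms s ↔ s ∈ stabGroup S ∧ s ∉ recoverable S ms := by
  rw [IsPermanentlyMasked, ← exists_obtainable_iff (σ := σ) hS hcomm, not_exists]

lemma span_temporarilyMasked_sup_span_unmasked {S : Fin r → Pauli n} {σ : Fin r → ℤˣ}
    (hS : LinearIndependent (ZMod 2) S) (hcomm : ∀ i j, symp (S i) (S j) = 0)
    (ms : List (Pauli n)) :
    Submodule.span (ZMod 2) {s | IsTemporarilyMasked S σ ms s} ⊔
      Submodule.span (ZMod 2) {s | IsUnmasked S σ ms s} = recoverable S ms := by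
  apply le_antisymm
  · rw [← Submodule.span_union, Submodule.span_le]
    rintro s (⟨-, -, h⟩ | ⟨-, h⟩)
    · exact (exists_obtainable_iff hS hcomm).1 h
    · exact (exists_obtainable_iff hS hcomm).1 ⟨[], by rwa [List.append_nil]⟩
  · intro s hs
    have hst := recoverable_le_stabGroup S ms hs
    by_cases h : Obtainable S σ ms s
    · exact Submodule.mem_sup_right (Submodule.subset_span ⟨hst, h⟩)
    · exact Submodule.mem_sup_left
        (Submodule.subset_span ⟨hst, h, (exists_obtainable_iff hS hcomm).2 hs⟩)

/-! ### The algorithm computes the group -/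

/-- The group generated by `C` and by `V`, the latter with trivial associated stabilizers. -/
def AlgState.groupCV (A : AlgState n) : Submodule (ZMod 2) (Pauli n × Pauli n) :=
  Submodule.span (ZMod 2) ({x | x ∈ A.C} ∪ (fun w => (w, 0)) '' {w | w ∈ A.V})

lemma AlgState.groupCV_eq (A : AlgState n) :
    A.groupCV = A.groupC ⊔ A.groupV.map (LinearMap.inl (ZMod 2) (Pauli n) (Pauli n)) := by
  rw [groupCV, groupC, groupV, Submodule.span_union, Submodule.map_span]
  rfl

/-! ### Generators of the intersection of a span with the kernel of a form -/

section Span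

variable {M : Type*} [AddCommGroup M] [Module (ZMod 2) M]

lemma span_inf_ker_of_forall {l : M →ₗ[ZMod 2] ZMod 2} {X : Set M} (h : ∀ y ∈ X, l y = 0) :
    Submodule.span (ZMod 2) X ⊓ LinearMap.ker l = Submodule.span (ZMod 2) X :=
  inf_eq_left.2 (Submodule.span_le.2 h)

lemma span_insert_inf_ker {l : M →ₗ[ZMod 2] ZMod 2} {X : Set M} {x : M} (hx : l x = 1) :
    Submodule.span (ZMod 2) (insert x X) ⊓ LinearMap.ker l =
      Submodule.span (ZMod 2) ((fun y => if l y = 1 then y + x else y) '' X) := by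
  have hfix : ∀ y, (if l y = 1 then y + x else y) = y + l y • x := fun y => by
    rcases zmod_two_cases (l y) with h | h <;> simp [h]
  have hl : ∀ y, l (y + l y • x) = 0 := fun y => by
    rw [map_add, map_smul, hx, smul_eq_mul, mul_one]
    exact CharTwo.add_self_eq_zero _
  simp only [hfix]
  apply le_antisymm
  · rintro w ⟨hw, hlw⟩
    -- `p` is the projection onto the kernel of `l` along `x`: it kills `x` in characteristic two
    -- and fixes the kernel, so it carries generators of the span to generators of the intersection.
    let p : M →ₗ[ZMod 2] M := LinearMap.id + l.smulRight x
    have hp : ∀ y, p y = y + l y • x := fun y => rfl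
    have hle : Submodule.span (ZMod 2) (insert x X) ≤
        (Submodule.span (ZMod 2) ((fun y => y + l y • x) '' X)).comap p := by
      rw [Submodule.span_le]
      rintro y (rfl | hy)
      · have h0 : p y = 0 := by
          rw [hp, hx, one_smul, ZModModule.add_self]
        rw [SetLike.mem_coe, Submodule.mem_comap, h0]
        exact Submodule.zero_mem _
      · exact Submodule.subset_span ⟨y, hy, rfl⟩
    have h := hle hw
    rwa [Submodule.mem_comap, hp, LinearMap.mem_ker.1 hlw, zero_smul, add_zero] at h
  · rw [Submodule.span_le]
    rintro _ ⟨y, hy, rfl⟩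
    exact ⟨Submodule.add_mem _ (Submodule.subset_span (Or.inr hy))
      (Submodule.smul_mem _ _ (Submodule.subset_span (Or.inl rfl))), hl y⟩

end Span

lemma updateC_eq_self {m : Pauli n} {C : Multiset (Pauli n × Pauli n)}
    (h : ∀ y ∈ C, symp y.1 m = 0) (x : Pauli n × Pauli n) : updateC m x C = C := by
  rw [updateC, Multiset.map_congr rfl (g := id) fun y hy => by simp [h y hy], Multiset.map_id]

lemma setOf_mem_updateV (m v : Pauli n) (V : Multiset (Pauli n)) :
    {w | w ∈ updateV m v V} = (fun w => if sympHom m w = 1 then w + v else w) '' {w | w ∈ V} := by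
  ext w
  simp only [updateV, Multiset.mem_map, Set.mem_ofPred_eq]
  rfl

lemma setOf_mem_updateC (m : Pauli n) (x : Pauli n × Pauli n) (C : Multiset (Pauli n × Pauli n)) :
    {y | y ∈ updateC m x C} =
      (fun y => if (sympHom m).comp (LinearMap.fst (ZMod 2) (Pauli n) (Pauli n)) y = 1
        then y + x else y) '' {y | y ∈ C} := by
  ext w
  simp only [updateC, Multiset.mem_map, Set.mem_ofPred_eq]
  rfl

lemma image_inl_updateV (m v : Pauli n) (V : Multiset (Pauli n)) :
    (fun w => (w, (0 : Pauli n))) '' {w | w ∈ updateV m v V} =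
      (fun y => if (sympHom m).comp (LinearMap.fst (ZMod 2) (Pauli n) (Pauli n)) y = 1
        then y + (v, 0) else y) '' ((fun w => (w, (0 : Pauli n))) '' {w | w ∈ V}) := by
  rw [setOf_mem_updateV, Set.image_image, Set.image_image]
  refine Set.image_congr fun w _ => ?_
  by_cases h : symp w m = 1 <;> simp [h]

lemma setOf_mem_cons {α : Type*} (a : α) (s : Multiset α) :
    {b | b ∈ a ::ₘ s} = insert a {b | b ∈ s} := by
  ext b
  simp

lemma AlgState.groupV_cons (C : Multiset (Pauli n × Pauli n)) (V : Multiset (Pauli n))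
    (m : Pauli n) :
    (AlgState.mk C (m ::ₘ V)).groupV =
      (AlgState.mk C V).groupV ⊔ Submodule.span (ZMod 2) {m} := by
  rw [groupV, setOf_mem_cons, Submodule.span_insert, sup_comm]
  rfl

lemma AlgState.groupCV_cons_V (C : Multiset (Pauli n × Pauli n)) (V : Multiset (Pauli n))
    (m : Pauli n) :
    (AlgState.mk C (m ::ₘ V)).groupCV = Submodule.span (ZMod 2)
      (insert (m, 0) ({x | x ∈ C} ∪ (fun w => (w, 0)) '' {w | w ∈ V})) := by
  rw [groupCV, setOf_mem_cons, Set.image_insert_eq, Set.union_insert]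

lemma AlgState.groupCV_cons_C (C : Multiset (Pauli n × Pauli n)) (V : Multiset (Pauli n))
    (x : Pauli n × Pauli n) :
    (AlgState.mk (x ::ₘ C) V).groupCV = Submodule.span (ZMod 2)
      (insert x ({x | x ∈ C} ∪ (fun w => (w, 0)) '' {w | w ∈ V})) := by
  rw [groupCV, setOf_mem_cons, Set.insert_union]

lemma AlgState.groupCV_cons_V_eq_sup (C : Multiset (Pauli n × Pauli n))
    (V : Multiset (Pauli n)) (m : Pauli n) :
    (AlgState.mk C (m ::ₘ V)).groupCV =
      (AlgState.mk C V).groupCV ⊔ Submodule.span (ZMod 2) {(m, 0)} := by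
  rw [groupCV_cons_V, Submodule.span_insert, sup_comm]
  rfl

lemma AlgState.groupCV_inf_ker {C : Multiset (Pauli n × Pauli n)} {V : Multiset (Pauli n)}
    {m : Pauli n} (hC : ∀ y ∈ C, symp y.1 m = 0) (hV : ∀ w ∈ V, symp w m = 0) :
    (AlgState.mk C V).groupCV ⊓
        LinearMap.ker ((sympHom m).comp (LinearMap.fst (ZMod 2) (Pauli n) (Pauli n))) =
      (AlgState.mk C V).groupCV := by
  apply span_inf_ker_of_forall
  rintro y (hy | ⟨w, hw, rfl⟩)
  · exact hC y hy
  · exact hV w hw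

lemma AlgState.groupV_inf_ker {C : Multiset (Pauli n × Pauli n)} {V : Multiset (Pauli n)}
    {m : Pauli n} (hV : ∀ w ∈ V, symp w m = 0) :
    (AlgState.mk C V).groupV ⊓ LinearMap.ker (sympHom m) = (AlgState.mk C V).groupV :=
  span_inf_ker_of_forall hV

lemma AlgState.groupV_cons_inf_ker (C C' : Multiset (Pauli n × Pauli n))
    (V : Multiset (Pauli n)) {m v : Pauli n} (hv : symp v m = 1) :
    (AlgState.mk C (v ::ₘ V)).groupV ⊓ LinearMap.ker (sympHom m) =
      (AlgState.mk C' (updateV m v V)).groupV := by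
  rw [groupV, groupV, setOf_mem_cons, span_insert_inf_ker (by exact hv), setOf_mem_updateV]

lemma AlgState.groupCV_cons_V_inf_ker (C : Multiset (Pauli n × Pauli n))
    (V : Multiset (Pauli n)) {m v : Pauli n} (hv : symp v m = 1) :
    (AlgState.mk C (v ::ₘ V)).groupCV ⊓
        LinearMap.ker ((sympHom m).comp (LinearMap.fst (ZMod 2) (Pauli n) (Pauli n))) =
      (AlgState.mk (updateC m (v, 0) C) (updateV m v V)).groupCV := by
  rw [groupCV_cons_V, span_insert_inf_ker (by exact hv), Set.image_union, groupCV,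
    image_inl_updateV, setOf_mem_updateC]

lemma AlgState.groupCV_cons_C_inf_ker (C : Multiset (Pauli n × Pauli n))
    {V : Multiset (Pauli n)} {m : Pauli n} {x : Pauli n × Pauli n} (hx : symp x.1 m = 1)
    (hV : ∀ w ∈ V, symp w m = 0) :
    (AlgState.mk (x ::ₘ C) V).groupCV ⊓
        LinearMap.ker ((sympHom m).comp (LinearMap.fst (ZMod 2) (Pauli n) (Pauli n))) =
      (AlgState.mk (updateC m x C) V).groupCV := by
  rw [groupCV_cons_C, span_insert_inf_ker (by exact hx), Set.image_union, groupCV,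
    setOf_mem_updateC, Set.image_image]
  congr 2
  refine Set.image_congr fun w hw => ?_
  simp [hV w hw]

/-! ### Invariants of the algorithm -/

lemma Step.groupV_eq {A B : AlgState n} {m : Pauli n} {R : Option (Pauli n × Pauli n)}
    (h : Step A m R B) : B.groupV = measUpdateV A.groupV m := by
  rw [measUpdateV]
  cases h with
  | case1_add C V _ hC hV hm => rw [AlgState.groupV_cons, AlgState.groupV_inf_ker hV]
  | case1_keep C V _ hC hV hm =>
    rw [AlgState.groupV_inf_ker hV, eq_comm, sup_eq_left, Submodule.span_singleton_le_iff_mem]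
    exact hm
  | case2 C V _ x hx hV =>
    rw [AlgState.groupV_inf_ker hV, AlgState.groupV_cons]
    rfl
  | case3 C V _ v hC hv => rw [AlgState.groupV_cons_inf_ker C C V hv, AlgState.groupV_cons]
  | case4 C V _ v hC hv =>
    rw [AlgState.groupV_cons_inf_ker C (updateC m (v, 0) C) V hv, AlgState.groupV_cons]

/-- Every case multiplies the anti-commuting generators by the removed one, which leaves generators
of the subgroup commuting with `m`. A removed `v` acts as `(v, 0)`, so associated stabilizers stay
unchanged in Case 4; Case 3 is the same computation with `C` fixed. -/
lemma Step.groupCV_eq {A B : AlgState n} {m : Pauli n} {R : Option (Pauli n × Pauli n)}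
    (h : Step A m R B) : B.groupCV = measUpdate A.groupCV m := by
  rw [measUpdate]
  cases h with
  | case1_add C V _ hC hV hm =>
    rw [AlgState.groupCV_cons_V_eq_sup, AlgState.groupCV_inf_ker hC hV]
  | case1_keep C V _ hC hV hm =>
    rw [AlgState.groupCV_inf_ker hC hV, eq_comm, sup_eq_left,
      Submodule.span_singleton_le_iff_mem, AlgState.groupCV_eq]
    exact Submodule.mem_sup_right ⟨m, hm, rfl⟩
  | case2 C V _ x hx hV =>
    rw [AlgState.groupCV_cons_C_inf_ker C hx hV, AlgState.groupCV_cons_V_eq_sup]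
  | case3 C V _ v hC hv =>
    rw [AlgState.groupCV_cons_V_inf_ker C V hv, AlgState.groupCV_cons_V_eq_sup,
      updateC_eq_self hC]
  | case4 C V _ v hC hv =>
    rw [AlgState.groupCV_cons_V_inf_ker C V hv, AlgState.groupCV_cons_V_eq_sup]

lemma Run.groupV_eq {A B : AlgState n} {ms : List (Pauli n)} (h : Run A ms B) :
    B.groupV = ms.foldl measUpdateV A.groupV := by
  induction h with
  | nil => rfl
  | cons h _ ih => rw [ih, h.groupV_eq, List.foldl_cons]

lemma Run.groupCV_eq {A B : AlgState n} {ms : List (Pauli n)} (h : Run A ms B) :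
    B.groupCV = ms.foldl measUpdate A.groupCV := by
  induction h with
  | nil => rfl
  | cons h _ ih => rw [ih, h.groupCV_eq, List.foldl_cons]

lemma AlgState.groupV_init (S : Fin r → Pauli n) : (AlgState.init S).groupV = ⊥ := by
  simp [groupV, init]

lemma AlgState.groupCV_init (S : Fin r → Pauli n) :
    (AlgState.init S).groupCV = diagGroup S := by
  have h : {x | x ∈ (AlgState.init S).C} = Set.range fun i => (S i, S i) := by
    ext x
    simp [init]
  rw [groupCV_eq, groupV_init, Submodule.map_bot, sup_bot_eq, groupC, h, diagGroup]

lemma Run.groupCV_eq_of_init {S : Fin r → Pauli n} {ms : List (Pauli n)} {A : AlgState n}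
    (h : Run (AlgState.init S) ms A) : A.groupCV = ms.foldl measUpdate (diagGroup S) := by
  rw [h.groupCV_eq, AlgState.groupCV_init]

/-- The operators in the group generated by `C` and `V` with trivial associated stabilizer are
those of `⟨V⟩`. -/
lemma Run.mem_groupV_of_init {S : Fin r → Pauli n} {ms : List (Pauli n)} {A : AlgState n}
    (h : Run (AlgState.init S) ms A) {d : Pauli n} (hd : (d, 0) ∈ A.groupCV) : d ∈ A.groupV := by
  rw [h.groupCV_eq_of_init] at hd
  -- Both groups start trivial, as the diagonal meets the operators paired with `0` only in the
  -- identity, and both evolve by `measUpdateV`.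
  rw [h.groupV_eq, AlgState.groupV_init, ← comap_inl_diagGroup S, ← comap_inl_foldl_measUpdate]
  exact hd

lemma Run.recoverable_eq {S : Fin r → Pauli n} {ms : List (Pauli n)} {A : AlgState n}
    (h : Run (AlgState.init S) ms A) :
    recoverable S ms = A.groupC.map (LinearMap.snd (ZMod 2) (Pauli n) (Pauli n)) := by
  rw [recoverable, ← h.groupCV_eq_of_init, AlgState.groupCV_eq, Submodule.map_sup,
    ← Submodule.map_comp, LinearMap.snd_comp_inl, Submodule.map_zero, sup_bot_eq]

lemma Run.span_output {S : Fin r → Pauli n} {ms : List (Pauli n)} {A : AlgState n}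
    {U T : Set (Pauli n)} (h : Run (AlgState.init S) ms A) (hUT : IsOutput A U T) :
    Submodule.span (ZMod 2) T ⊔ Submodule.span (ZMod 2) U = recoverable S ms := by
  have hC : A.groupC.map (LinearMap.snd (ZMod 2) (Pauli n) (Pauli n)) =
      Submodule.span (ZMod 2) (Prod.snd '' {x | x ∈ A.C}) := by
    rw [AlgState.groupC, Submodule.map_span]
    rfl
  rw [h.recoverable_eq]
  apply le_antisymm
  · refine sup_le ?_ ?_
    · rw [hC, hUT.T_eq]
      refine Submodule.span_mono ?_
      rintro s ⟨⟨c, hc⟩, -⟩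
      exact ⟨(c, s), hc, rfl⟩
    · rw [hUT.span_U]
      exact Submodule.map_mono inf_le_left
  · rw [hC, Submodule.span_le]
    rintro _ ⟨⟨c, s⟩, hc, rfl⟩
    by_cases hs : s ∈ Submodule.span (ZMod 2) U
    · exact Submodule.mem_sup_right hs
    · refine Submodule.mem_sup_left (Submodule.subset_span ?_)
      rw [hUT.T_eq]
      exact ⟨⟨c, hc⟩, hs⟩

/-- The stabilizer associated with an operator removed from `C` is no longer recoverable. -/
lemma Run.notMem_recoverable_of_removed {S : Fin r → Pauli n} {ms : List (Pauli n)}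
    {m c s : Pauli n} {A B : AlgState n} (h : Run (AlgState.init S) ms A)
    (hstep : Step A m (some (c, s)) B) :
    s ∈ recoverable S ms ∧ s ∉ recoverable S (ms ++ [m]) := by
  obtain ⟨hmem, hc, hV⟩ : (c, s) ∈ A.groupCV ∧ symp c m = 1 ∧ ∀ w ∈ A.V, symp w m = 0 := by
    cases hstep with
    | case2 C V _ _ hx hV =>
      exact ⟨Submodule.subset_span (Or.inl (Multiset.mem_cons_self _ _)), hx, hV⟩
  have hmem' := h.groupCV_eq_of_init ▸ hmem
  refine ⟨⟨_, hmem', rfl⟩, ?_⟩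
  rintro ⟨⟨d, t⟩, hd, rfl⟩
  rw [List.foldl_append, List.foldl_cons, List.foldl_nil, ← h.groupCV_eq_of_init] at hd
  obtain ⟨⟨y, u⟩, hy, hym, a, hya⟩ := mem_measUpdate.1 hd
  have htu : t = u := by simpa using congrArg Prod.snd hya
  -- If `s` survived, it would come from some `(y, s)` with `y` commuting with `m`. Then `c + y` is
  -- paired with `0`, so it lies in `⟨V⟩` and commutes with `m`, whereas `c` does not.
  have hcy : (c + y, 0) ∈ A.groupCV := by
    have := A.groupCV.add_mem hmem hy
    rwa [LinearMap.snd_apply, htu, Prod.mk_add_mk, ZModModule.add_self] at this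
  have hV' : A.groupV ≤ LinearMap.ker (sympHom m) := Submodule.span_le.2 hV
  have h0 : symp (c + y) m = 0 := hV' (h.mem_groupV_of_init hcy)
  rw [symp_add_left, hc, hym] at h0
  exact absurd h0 (by decide)

end DynCode

theorem mainTheorem5 (n r : ℕ) (S : Fin r → Pauli n) (σ : Fin r → ℤˣ)
    (hS : LinearIndependent (ZMod 2) S) (hcomm : ∀ i j, symp (S i) (S j) = 0) :
    -- an element removed from `C` before its associated stabilizer was unmasked
    (∀ (ms : List (Pauli n)) (m c s : Pauli n) (A B : AlgState n),
      Run (AlgState.init S) ms A → Step A m (some (c, s)) B → ¬ IsUnmasked S σ ms s →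
        IsPermanentlyMasked S σ (ms ++ [m]) s) ∧
    -- the permanently masked stabilizers, in terms of the output of the algorithm
    (∀ (ms : List (Pauli n)) (A : AlgState n) (U T : Set (Pauli n)),
      Run (AlgState.init S) ms A → IsOutput A U T →
        {s | IsPermanentlyMasked S σ ms s} =
          (stabGroup S : Set (Pauli n)) \
            ↑(Submodule.span (ZMod 2) T ⊔ Submodule.span (ZMod 2) U)) ∧
    -- and in terms of all temporarily masked and all unmasked stabilizers
    (∀ ms : List (Pauli n),
      {s | IsPermanentlyMasked S σ ms s} =
        (stabGroup S : Set (Pauli n)) \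
          ↑(Submodule.span (ZMod 2) {s | IsTemporarilyMasked S σ ms s} ⊔
            Submodule.span (ZMod 2) {s | IsUnmasked S σ ms s})) := by
  refine ⟨fun ms m c s A B hrun hstep _ => ?_, fun ms A U T hrun hUT => ?_, fun ms => ?_⟩
  · obtain ⟨h1, h2⟩ := hrun.notMem_recoverable_of_removed hstep
    exact (isPermanentlyMasked_iff hS hcomm).2 ⟨recoverable_le_stabGroup S ms h1, h2⟩
  · rw [hrun.span_output hUT]
    ext s
    exact isPermanentlyMasked_iff hS hcomm
  · rw [span_temporarilyMasked_sup_span_unmasked hS hcomm]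
    ext s
    exact isPermanentlyMasked_iff hS hcomm
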